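/- The hedgehog $H_t$ ($t \ge 1$) is the $3$-uniform hypergraph whose vertex set consists of $t$ vertices $1,\dots,t$ (the body) together with $\binom{t}{2}$ further vertices $k_{ij}$, one for each pair $1 \le i < j \le t$, and whose edges are the triples $\{i, j, k_{ij}\}$. Let $r_3(H_t;3)$ be the smallest $n$ such that every $3$-colouring of the edges of the complete $3$-uniform hypergraph on $n$ vertices contains a monochromatic copy of $H_t$. Let $F(t)$ be the smallest $n$ such that every $4$-colouring of the edges of the complete graph $K_n$, in red, blue, green and yellow, contains either a rainbow triangle with one edge in each of red, blue and green, or a clique of order $t$ whose edges receive at most $3$ colours. Then $r_3(H_t;3)$ and $F(t)$ exist (are finite) for every $t \ge 1$, and (i) $r_3(H_t;3) = O(t^4 F(t^3)^2)$, that is, there is a constant $C > 0$ such that $r_3(H_t;3) \le C\, t^4 F(t^3)^2$ for all $t \ge 1$; (ii) $r_3(H_t;3) \ge F(t)$ for all $t \ge 1$. In particular, there is a constant $c > 0$ such that $r_3(H_t;3) \le t^{c \log t}$ for all $t \ge 1$, where $\log$ is the natural logarithm. -/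

import Mathlib

/-- A `k`-uniform hypergraph on the vertex set `V`, given by its set of edges. -/
abbrev UniformHypergraph (V : Type*) (k : ℕ) : Type _ := Set (Set.powersetCard V k)

/-- Every colouring with `q` colours of the edges of the complete `k`-uniform hypergraph on
`n` vertices contains a monochromatic copy of `H`. -/
def RamseyArrows {V : Type*} {k : ℕ} (H : UniformHypergraph V k) (q n : ℕ) : Prop :=
  ∀ χ : Set.powersetCard (Fin n) k → Fin q,
    ∃ (f : V ↪ Fin n) (c : Fin q), ∀ e ∈ H, χ (Set.powersetCard.map k f e) = c

/-- The `q`-colour Ramsey number `r_k(H; q)`. -/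
noncomputable def ramseyNumber {V : Type*} {k : ℕ} (H : UniformHypergraph V k) (q : ℕ) : ℕ :=
  sInf {n : ℕ | RamseyArrows H q n}

/-- The vertices of the hedgehog with body of order `t`: the body `Fin t`, and one further
vertex for every pair of vertices of the body. -/
abbrev HedgehogVertex (t : ℕ) : Type := Fin t ⊕ Set.powersetCard (Fin t) 2

theorem card_hedgehogVertex (t : ℕ) : Nat.card (HedgehogVertex t) = t + t.choose 2 := by
  rw [Nat.card_sum, Set.powersetCard.card]
  simp

/-- The edge `{i, j, k}`, where `k` is the vertex attached to the pair `{i, j}` of the body. -/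
def hedgehogEdge {t : ℕ} (p : Set.powersetCard (Fin t) 2) :
    Set.powersetCard (HedgehogVertex t) 3 :=
  ⟨(p : Finset (Fin t)).disjSum {p}, by
    have h : (p : Finset (Fin t)).card = 2 := p.2
    rw [Set.powersetCard.mem_iff, Finset.card_disjSum, h, Finset.card_singleton]⟩

/-- The `3`-uniform hedgehog `H_t` with body of order `t`. -/
def hedgehog (t : ℕ) : UniformHypergraph (HedgehogVertex t) 3 := Set.range hedgehogEdge

inductive EdgeColour : Type
  | red
  | blue
  | green
  | yellow

/-- A `4`-colouring of the edges of the complete graph `K_n`. -/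
abbrev FourColouring (n : ℕ) : Type := (⊤ : SimpleGraph (Fin n)).edgeSet → EdgeColour

/-- There is a triangle with one edge in each of red, blue and green. -/
def HasRainbowTriangle {n : ℕ} (χ : FourColouring n) : Prop :=
  ∃ (u v w : Fin n) (huv : (⊤ : SimpleGraph (Fin n)).Adj u v)
    (hvw : (⊤ : SimpleGraph (Fin n)).Adj v w) (huw : (⊤ : SimpleGraph (Fin n)).Adj u w),
    χ ⟨s(u, v), huv⟩ = EdgeColour.red ∧ χ ⟨s(v, w), hvw⟩ = EdgeColour.blue ∧
      χ ⟨s(u, w), huw⟩ = EdgeColour.green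

/-- The set of colours that appear on the edges of the clique with vertex set `S`. -/
def cliqueColours {n : ℕ} (χ : FourColouring n) (S : Finset (Fin n)) : Set EdgeColour :=
  {c | ∃ e : (⊤ : SimpleGraph (Fin n)).edgeSet, (∀ v ∈ (e : Sym2 (Fin n)), v ∈ S) ∧ χ e = c}

/-- Every `4`-colouring of the edges of `K_n` contains a red/blue/green rainbow triangle or a
clique of order `t` with at most `3` colours. -/
def RainbowOrClique (t n : ℕ) : Prop :=
  ∀ χ : FourColouring n, HasRainbowTriangle χ ∨
    ∃ S : Finset (Fin n), S.card = t ∧ (cliqueColours χ S).encard ≤ 3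

/-- The function `F(t)`: the smallest `n` with `RainbowOrClique t n`. -/
noncomputable def rainbowF (t : ℕ) : ℕ := sInf {n : ℕ | RainbowOrClique t n}

/-! Upper bound: call a pair related in colour `c` if fewer than `t ^ 2` triples of colour `c`
contain it. By Hall's theorem a `t`-set with no pair related in `c` is the body of a hedgehog of
colour `c` (`exists_hedgehog_embedding`). Only `O(t ^ 2 * N ^ 2)` triples have related pairs in all
three colours, since such a triple has a pair related in some colour that is its own
(`card_poorTriples_le`); so a set of order about `√N / t` contains none of them. If no colour has a
free `t`-set, deleting `3 * t` vertices leaves no pair related in two colours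
(`exists_subset_related_unique`). Colouring each pair by the colour it is related in, and unrelated
pairs yellow, gives no rainbow triangle, so `F(t ^ 3)` vertices yield a `t ^ 3`-clique missing a
colour. If that colour is yellow, the clique carries a Gallai colouring, which has a `t`-subset
missing another colour.

Lower bound: without rainbow triangles every triple misses red, blue or green; colour it by a
missing one. The body of a monochromatic hedgehog then misses that colour.

Quasipolynomial growth: the Erdős–Hajnal recursion `exists_hasLargeFreeProduct` bounds `F`. It and
the Gallai step share an invariant: a set whose order is at most the product of the orders of one
free subset per colour. `HasLargeFreeProduct.union` preserves it when some colour is absent between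
the two parts. -/

/-! ### Free sets, Gallai colourings and the Erdős–Hajnal recursion -/

section FreeSets

open scoped Classical

/-- No two distinct vertices of `S` are related by `E`. -/
def IsFree {V : Type*} (E : V → V → Prop) (S : Finset V) : Prop :=
  ∀ u ∈ S, ∀ v ∈ S, u ≠ v → ¬ E u v

/-- `W` has subsets `P c`, each free of the edges of colour `c`, the product of whose orders is at
least the order of `W`. -/
def HasLargeFreeProduct {V : Type*} (E : Fin 3 → V → V → Prop) (W : Finset V) : Prop :=
  ∃ P : Fin 3 → Finset V, (∀ c, P c ⊆ W) ∧ (∀ c, IsFree (E c) (P c)) ∧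
    W.card ≤ ∏ c, (P c).card

theorem IsFree.mono {V : Type*} {E : V → V → Prop} {S T : Finset V} (h : IsFree E T)
    (hST : S ⊆ T) : IsFree E S :=
  fun u hu v hv huv => h u (hST hu) v (hST hv) huv

theorem isFree_singleton {V : Type*} (E : V → V → Prop) (v : V) : IsFree E {v} := by
  intro u hu w hw huw
  simp only [Finset.mem_singleton] at hu hw
  exact absurd (hu.trans hw.symm) huw

theorem IsFree.union {V : Type*} {E : V → V → Prop} (hE : ∀ u v, E u v → E v u)
    {S T : Finset V} (hS : IsFree E S) (hT : IsFree E T) (hST : ∀ a ∈ S, ∀ b ∈ T, ¬ E a b) :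
    IsFree E (S ∪ T) := by
  intro u hu v hv huv
  rcases Finset.mem_union.1 hu with hu | hu <;> rcases Finset.mem_union.1 hv with hv | hv
  · exact hS u hu v hv huv
  · exact hST u hu v hv
  · exact fun h => hST v hv u hu (hE _ _ h)
  · exact hT u hu v hv huv

theorem hasLargeFreeProduct_singleton {V : Type*} (E : Fin 3 → V → V → Prop) (v : V) :
    HasLargeFreeProduct E {v} :=
  ⟨fun _ => {v}, fun _ => subset_rfl, fun _ => isFree_singleton _ v, by simp⟩

/-- In colour `c` the two free sets merge and their orders add; in each other colour the larger one
is kept. The product is then at least the sum of the two products. -/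
theorem HasLargeFreeProduct.union {V : Type*} {E : Fin 3 → V → V → Prop}
    (hE : ∀ c u v, E c u v → E c v u) {A B : Finset V} (hA : HasLargeFreeProduct E A)
    (hB : HasLargeFreeProduct E B) (hAB : Disjoint A B) (c : Fin 3)
    (hc : ∀ a ∈ A, ∀ b ∈ B, ¬ E c a b) : HasLargeFreeProduct E (A ∪ B) := by
  obtain ⟨P, hPA, hP, hPc⟩ := hA
  obtain ⟨Q, hQB, hQ, hQc⟩ := hB
  let R : Fin 3 → Finset V := fun i =>
    if i = c then P i ∪ Q i else if (P i).card ≤ (Q i).card then Q i else P i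
  have hRc : (R c).card = (P c).card + (Q c).card := by
    simp only [R, if_true]
    exact Finset.card_union_of_disjoint (hAB.mono (hPA c) (hQB c))
  have hR : ∀ i ∈ Finset.univ.erase c, (P i).card ≤ (R i).card ∧ (Q i).card ≤ (R i).card := by
    intro i hi
    have hic : i ≠ c := Finset.ne_of_mem_erase hi
    simp only [R, if_neg hic]
    split_ifs with h
    · exact ⟨h, le_rfl⟩
    · exact ⟨le_rfl, (not_le.1 h).le⟩
  refine ⟨R, ?_, ?_, ?_⟩
  · intro i
    simp only [R]
    split_ifs
    · exact Finset.union_subset_union (hPA i) (hQB i)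
    · exact (hQB i).trans Finset.subset_union_right
    · exact (hPA i).trans Finset.subset_union_left
  · intro i
    simp only [R]
    split_ifs with h1 h2
    · subst h1
      exact (hP i).union (hE i) (hQ i) fun a ha b hb => hc a (hPA i ha) b (hQB i hb)
    · exact hQ i
    · exact hP i
  · rw [Finset.card_union_of_disjoint hAB]
    calc A.card + B.card ≤ ∏ i, (P i).card + ∏ i, (Q i).card := add_le_add hPc hQc
      _ = (P c).card * ∏ i ∈ Finset.univ.erase c, (P i).card
          + (Q c).card * ∏ i ∈ Finset.univ.erase c, (Q i).card := by
        rw [Finset.mul_prod_erase _ (fun i => (P i).card) (Finset.mem_univ c),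
          Finset.mul_prod_erase _ (fun i => (Q i).card) (Finset.mem_univ c)]
      _ ≤ (P c).card * ∏ i ∈ Finset.univ.erase c, (R i).card
          + (Q c).card * ∏ i ∈ Finset.univ.erase c, (R i).card := by
        exact add_le_add
          (Nat.mul_le_mul_left _ (Finset.prod_le_prod' fun i hi => (hR i hi).1))
          (Nat.mul_le_mul_left _ (Finset.prod_le_prod' fun i hi => (hR i hi).2))
      _ = ∏ i, (R i).card := by
        rw [← add_mul, ← hRc, Finset.mul_prod_erase _ (fun i => (R i).card) (Finset.mem_univ c)]

/-- A set of order at least `t ^ 3` with a large product of free sets has a free set of order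
`t`. -/
theorem HasLargeFreeProduct.exists_isFree {V : Type*} {E : Fin 3 → V → V → Prop} {W : Finset V}
    (hW : HasLargeFreeProduct E W) {t : ℕ} (ht : t ^ 3 ≤ W.card) :
    ∃ c, ∃ S ⊆ W, S.card = t ∧ IsFree (E c) S := by
  obtain ⟨P, hPW, hP, hc⟩ := hW
  obtain ⟨c, h⟩ : ∃ c, t ≤ (P c).card := by
    by_contra! h
    rcases Nat.eq_zero_or_pos t with rfl | htpos
    · exact absurd (h 0) (Nat.not_lt_zero _)
    have h1 : ∏ c, (P c).card ≤ ∏ _c : Fin 3, (t - 1) :=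
      Finset.prod_le_prod' fun i _ => Nat.le_sub_one_of_lt (h i)
    have h2 : (t - 1) ^ 3 < t ^ 3 := Nat.pow_lt_pow_left (by omega) (by norm_num)
    simp only [Finset.prod_const, Finset.card_univ, Fintype.card_fin] at h1
    omega
  obtain ⟨S, hS, hSc⟩ := Finset.exists_subset_card_eq h
  exact ⟨c, S, hS.trans (hPW c), hSc, (hP c).mono hS⟩

/-- Gallai: if a `3`-colouring of the complete graph on `S` has no rainbow triangle, then some
colour does not connect `S`. -/
theorem exists_cut_avoiding_colour {V : Type*} {f : V → V → Fin 3} (hf : ∀ u v, f u v = f v u)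
    (S : Finset V) (hS : 2 ≤ S.card)
    (hno : ∀ u ∈ S, ∀ v ∈ S, ∀ w ∈ S, u ≠ v → v ≠ w → u ≠ w →
      f u v = f v w ∨ f v w = f u w ∨ f u v = f u w) :
    ∃ c, ∃ A ⊆ S, A.Nonempty ∧ (S \ A).Nonempty ∧ ∀ a ∈ A, ∀ b ∈ S \ A, f a b ≠ c := by
  induction S using Finset.induction_on with
  | empty => simp at hS
  | insert v S hv ih =>
    rcases lt_or_ge S.card 2 with hlt | hge
    · have h1 : S.card = 1 := by
        rw [Finset.card_insert_of_notMem hv] at hS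
        omega
      obtain ⟨x, rfl⟩ := Finset.card_eq_one.1 h1
      obtain ⟨c, hc⟩ := exists_ne (f v x)
      have hvx : v ≠ x := by simpa using hv
      refine ⟨c, {v}, by simp, by simp, ⟨x, by simp [hvx.symm]⟩, ?_⟩
      intro a ha b hb
      simp only [Finset.mem_sdiff, Finset.mem_insert, Finset.mem_singleton] at ha hb
      obtain rfl : b = x := by tauto
      rw [ha]
      exact hc.symm
    have hsub : S ⊆ insert v S := Finset.subset_insert v S
    obtain ⟨c, A, hAS, hA, hA', hcut⟩ := ih hge fun u hu x hx w hw =>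
      hno u (hsub hu) x (hsub hx) w (hsub hw)
    -- Now every colour connects `insert v S`, while `c` does not connect `S`. Below, `conn` is
    -- lying in the same `c`-component of `S`; each component must receive an edge of colour `c`
    -- from `v`.
    by_contra! hcon
    let r : V → V → Prop := fun x y => x ∈ S ∧ y ∈ S ∧ f x y = c
    have hr : Std.Symm r := ⟨fun x y h => ⟨h.2.1, h.1, (hf y x).trans h.2.2⟩⟩
    let conn : V → V → Prop := Relation.ReflTransGen r
    have hsymm : ∀ {x y}, conn x y → conn y x := fun {x y} h =>
      Relation.ReflTransGen.stdSymm.symm x y h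
    have hne : ∀ x ∈ S, v ≠ x := fun x hx h => hv (h ▸ hx)
    have hgreen : ∀ x ∈ S, ∃ a ∈ S, conn x a ∧ f v a = c := by
      intro x hx
      obtain ⟨a, ha, b, hb, hab⟩ := hcon c (S.filter (conn x))
        ((Finset.filter_subset _ _).trans hsub)
        ⟨x, Finset.mem_filter.2 ⟨hx, Relation.ReflTransGen.refl⟩⟩
        ⟨v, by simp [hv]⟩
      simp only [Finset.mem_filter, Finset.mem_sdiff, Finset.mem_insert, not_and] at ha hb
      rcases hb.1 with rfl | hbS
      · exact ⟨a, ha.1, ha.2, (hf _ _).trans hab⟩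
      · exact absurd (ha.2.tail ⟨ha.1, hbS, hab⟩) (hb.2 hbS)
    have hall : ∀ d, ∃ x ∈ S, f v x = d := by
      intro d
      obtain ⟨a, ha, b, hb, hab⟩ := hcon d {v} (by simp) (by simp)
        (by
          obtain ⟨x, hx⟩ := hA
          exact ⟨x, by simp [hAS hx, (hne x (hAS hx)).symm]⟩)
      simp only [Finset.mem_sdiff, Finset.mem_insert, Finset.mem_singleton] at ha hb
      exact ⟨b, by tauto, ha ▸ hab⟩
    -- Between components no edge has colour `c`, so along a `c`-edge the colour towards an outside
    -- vertex cannot change without a rainbow triangle.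
    have hconst : ∀ x ∈ S, ∀ z ∈ S, ¬ conn x z → ∀ x', conn x x' → f x z = f x' z := by
      intro x hx z hz hxz x' hx'
      induction hx' with
      | refl => rfl
      | @tail y w hy hyw ihy =>
        have hyz : ¬ conn y z := fun h => hxz (Relation.ReflTransGen.trans hy h)
        have hwz : ¬ conn w z := fun h => hxz (Relation.ReflTransGen.trans (hy.tail hyw) h)
        rw [ihy]
        by_cases hyw' : y = w
        · rw [hyw']
        have h1 : f y z ≠ c := fun h => hyz (Relation.ReflTransGen.single ⟨hyw.1, hz, h⟩)
        have h2 : f w z ≠ c := fun h => hwz (Relation.ReflTransGen.single ⟨hyw.2.1, hz, h⟩)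
        have h3 : y ≠ z := fun h => hyz (h ▸ Relation.ReflTransGen.refl)
        have h4 : w ≠ z := fun h => hwz (h ▸ Relation.ReflTransGen.refl)
        rcases hno y (hsub hyw.1) w (hsub hyw.2.1) z (hsub hz) hyw' h4 h3 with h | h | h
        · exact absurd (h.symm.trans hyw.2.2) h2
        · exact h.symm
        · exact absurd (h.symm.trans hyw.2.2) h1
    -- The component of `z` has a vertex `a` with `v a` of colour `c`; the triangle `v x a` forces
    -- the colour of `x a`, and `hconst` carries it to `x z`.
    have hspread : ∀ x ∈ S, ∀ z ∈ S, ¬ conn x z → f v x ≠ c → f x z = f v x := by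
      intro x hx z hz hxz hvx
      obtain ⟨a, haS, hza, hva⟩ := hgreen z hz
      have hxa : ¬ conn x a := fun h => hxz (Relation.ReflTransGen.trans h (hsymm hza))
      have h1 : f x a ≠ c := fun h => hxa (Relation.ReflTransGen.single ⟨hx, haS, h⟩)
      have h2 : x ≠ a := fun h => hxa (h ▸ Relation.ReflTransGen.refl)
      have h3 : f z x = f a x := hconst z hz x hx (fun h => hxz (hsymm h)) a hza
      have h4 : f x a = f v x := by
        rcases hno v (Finset.mem_insert_self v S) x (hsub hx) a (hsub haS) (hne x hx) h2
          (hne a haS) with h | h | h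
        · exact h.symm
        · exact absurd (h.trans hva) h1
        · exact absurd (h.trans hva) hvx
      rw [hf x z, h3, hf a x, h4]
    obtain ⟨d₁, d₂, h1, h2, h12⟩ : ∃ d₁ d₂ : Fin 3, d₁ ≠ c ∧ d₂ ≠ c ∧ d₁ ≠ d₂ := by
      clear * -
      fin_cases c
      exacts [⟨1, 2, by simp⟩, ⟨0, 2, by simp⟩, ⟨0, 1, by simp⟩]
    obtain ⟨x, hx, hvx⟩ := hall d₁
    obtain ⟨y, hy, hvy⟩ := hall d₂
    -- In one component, `x` and `y` must agree towards any vertex outside it; in different ones,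
    -- the edge `x y` itself gets both colours.
    by_cases hxy : conn x y
    · obtain ⟨z, hz, hxz⟩ : ∃ z ∈ S, ¬ conn x z := by
        have hclosed : ∀ p q, conn p q → p ∈ S → (p ∈ A ↔ q ∈ A) := by
          intro p q hpq _
          induction hpq with
          | refl => rfl
          | @tail y w _ hyw ihy =>
            rw [ihy]
            constructor
            · intro hyA
              by_contra hwA
              exact hcut y hyA w (Finset.mem_sdiff.2 ⟨hyw.2.1, hwA⟩) hyw.2.2
            · intro hwA
              by_contra hyA
              exact hcut w hwA y (Finset.mem_sdiff.2 ⟨hyw.1, hyA⟩) ((hf _ _).trans hyw.2.2)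
        obtain ⟨p, hp⟩ := hA
        obtain ⟨q, hq⟩ := hA'
        rw [Finset.mem_sdiff] at hq
        by_cases hxA : x ∈ A
        · exact ⟨q, hq.1, fun h => hq.2 ((hclosed x q h hx).1 hxA)⟩
        · exact ⟨p, hAS hp, fun h => hxA ((hclosed x p h hx).2 hp)⟩
      have hyz : ¬ conn y z := fun h => hxz (Relation.ReflTransGen.trans hxy h)
      have e1 := hspread x hx z hz hxz (hvx ▸ h1)
      have e2 := hspread y hy z hz hyz (hvy ▸ h2)
      have e3 := hconst x hx z hz hxz y hxy
      exact h12 (hvx ▸ hvy ▸ (e1.symm.trans (e3.trans e2)))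
    · have e1 := hspread x hx y hy hxy (hvx ▸ h1)
      have e2 := hspread y hy x hx (fun h => hxy (hsymm h)) (hvy ▸ h2)
      exact h12 (hvx ▸ hvy ▸ (e1.symm.trans ((hf x y).trans e2)))

/-- Split along a cut that avoids one colour, recurse on both sides, and merge. -/
theorem hasLargeFreeProduct_of_no_rainbow {V : Type*} {f : V → V → Fin 3}
    (hf : ∀ u v, f u v = f v u) (S : Finset V) (hS : S.Nonempty)
    (hno : ∀ u ∈ S, ∀ v ∈ S, ∀ w ∈ S, u ≠ v → v ≠ w → u ≠ w →
      f u v = f v w ∨ f v w = f u w ∨ f u v = f u w) :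
    HasLargeFreeProduct (fun c u v => f u v = c) S := by
  induction S using Finset.strongInduction with
  | H S ih =>
    rcases lt_or_ge S.card 2 with hlt | hge
    · have h1 : S.card = 1 := by
        have := hS.card_pos
        omega
      obtain ⟨x, rfl⟩ := Finset.card_eq_one.1 h1
      exact hasLargeFreeProduct_singleton _ x
    obtain ⟨c, A, hAS, hA, hA', hcut⟩ := exists_cut_avoiding_colour hf S hge hno
    have hlt : A ⊂ S := by
      refine hAS.ssubset_of_ne fun h => ?_
      simp [h] at hA'
    have hlt' : S \ A ⊂ S := Finset.sdiff_ssubset hAS hA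
    have key := HasLargeFreeProduct.union (E := fun c u v => f u v = c)
      (fun c u v h => (hf v u).trans h)
      (ih A hlt hA fun u hu v hv w hw => hno u (hAS hu) v (hAS hv) w (hAS hw))
      (ih (S \ A) hlt' hA' fun u hu v hv w hw =>
        hno u (hlt'.1 hu) v (hlt'.1 hv) w (hlt'.1 hw))
      Finset.disjoint_sdiff c hcut
    rwa [Finset.union_sdiff_of_subset hAS] at key

/-- If no triangle carries edges of all three colours, then two large disjoint sets have low
density in one of the colours. -/
theorem exists_sparse_pair {V : Type*} {E : Fin 3 → V → V → Prop}
    {q p : ℕ} (hq : 2 ≤ q) (U : Finset V) (hU : 3 * (q * p) ≤ U.card)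
    (hno : ∀ u ∈ U, ∀ v ∈ U, ∀ w ∈ U, ¬ (E 0 u v ∧ E 1 u w ∧ E 2 v w)) :
    ∃ c, ∃ A ⊆ U, ∃ B ⊆ U, Disjoint A B ∧ p ≤ A.card ∧ p ≤ B.card ∧
      ∀ a ∈ A, q * (B.filter (E c a)).card ≤ B.card := by
  obtain ⟨V₁, hV₁, hc₁⟩ := Finset.exists_subset_card_eq (s := U) (n := q * p) (by omega)
  obtain ⟨V₂, hV₂, hc₂⟩ := Finset.exists_subset_card_eq (s := U \ V₁) (n := q * p) (by
    rw [Finset.card_sdiff_of_subset hV₁]; omega)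
  have h12 : Disjoint V₁ V₂ := (Finset.disjoint_sdiff).mono_right hV₂
  have hU12 : V₁ ∪ V₂ ⊆ U := Finset.union_subset hV₁ (hV₂.trans Finset.sdiff_subset)
  obtain ⟨V₃, hV₃, hc₃⟩ := Finset.exists_subset_card_eq (s := U \ (V₁ ∪ V₂)) (n := q * p) (by
    rw [Finset.card_sdiff_of_subset hU12, Finset.card_union_of_disjoint h12]; omega)
  have h123 : Disjoint (V₁ ∪ V₂) V₃ := (Finset.disjoint_sdiff).mono_right hV₃
  have h13 : Disjoint V₁ V₃ := h123.mono_left Finset.subset_union_left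
  have h23 : Disjoint V₂ V₃ := h123.mono_left Finset.subset_union_right
  have hV₂' : V₂ ⊆ U := Finset.subset_union_right.trans hU12
  have hV₃' : V₃ ⊆ U := hV₃.trans Finset.sdiff_subset
  have hp : p ≤ q * p := Nat.le_mul_of_pos_left p (by omega)
  -- A vertex of `V₁` dense to both other classes has two neighbourhoods with no edge of colour `2`
  -- between them. Otherwise every vertex of `V₁` is sparse to `V₂` in colour `0` or to `V₃` in
  -- colour `1`, and one alternative holds for at least half.
  by_cases hv : ∃ v ∈ V₁, V₂.card < q * (V₂.filter (E 0 v)).card ∧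
      V₃.card < q * (V₃.filter (E 1 v)).card
  · obtain ⟨v, hv, h2, h3⟩ := hv
    rw [hc₂] at h2
    rw [hc₃] at h3
    refine ⟨2, V₂.filter (E 0 v), (Finset.filter_subset _ _).trans hV₂', V₃.filter (E 1 v),
      (Finset.filter_subset _ _).trans hV₃',
      h23.mono (Finset.filter_subset _ _) (Finset.filter_subset _ _),
      (Nat.lt_of_mul_lt_mul_left h2).le, (Nat.lt_of_mul_lt_mul_left h3).le, ?_⟩
    intro a ha
    rw [Finset.mem_filter] at ha
    rw [Finset.filter_eq_empty_iff.2]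
    · simp
    · intro b hb hab
      rw [Finset.mem_filter] at hb
      exact hno v (hV₁ hv) a (hV₂' ha.1) b (hV₃' hb.1) ⟨ha.2, hb.2, hab⟩
  · push Not at hv
    let A := V₁.filter fun v => q * (V₂.filter (E 0 v)).card ≤ V₂.card
    have hsum : A.card + (V₁.filter fun v =>
        ¬ q * (V₂.filter (E 0 v)).card ≤ V₂.card).card = q * p := by
      rw [← hc₁]
      exact Finset.card_filter_add_card_filter_not _
    have hqp : 2 * p ≤ q * p := Nat.mul_le_mul_right p hq
    rcases le_or_gt p A.card with hA | hA
    · refine ⟨0, A, (Finset.filter_subset _ _).trans hV₁, V₂, hV₂',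
        h12.mono_left (Finset.filter_subset _ _), hA, by omega, ?_⟩
      intro a ha
      exact (Finset.mem_filter.1 ha).2
    · refine ⟨1, V₁.filter fun v => ¬ q * (V₂.filter (E 0 v)).card ≤ V₂.card,
        (Finset.filter_subset _ _).trans hV₁, V₃, hV₃',
        h13.mono_left (Finset.filter_subset _ _), ?_, by omega, ?_⟩
      · omega
      · intro a ha
        rw [Finset.mem_filter] at ha
        exact hv a ha.1 (not_le.1 ha.2)

/-- The Erdős–Hajnal recursion. -/
theorem exists_hasLargeFreeProduct {V : Type*} {E : Fin 3 → V → V → Prop}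
    (hE : ∀ c u v, E c u v → E c v u) {q : ℕ} (k : ℕ) (hk : 2 ^ k ≤ q) (hq : 2 ≤ q)
    (U : Finset V) (hU : (6 * q) ^ k ≤ U.card)
    (hno : ∀ u ∈ U, ∀ v ∈ U, ∀ w ∈ U, ¬ (E 0 u v ∧ E 1 u w ∧ E 2 v w)) :
    ∃ W ⊆ U, W.card = 2 ^ k ∧ HasLargeFreeProduct E W := by
  induction k generalizing U with
  | zero =>
    obtain ⟨x, hx⟩ : U.Nonempty := Finset.card_pos.1 (by simpa using hU)
    exact ⟨{x}, by simpa using hx, by simp, hasLargeFreeProduct_singleton _ x⟩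
  | succ k ih =>
    have hk' : 2 * 2 ^ k ≤ q := by rwa [pow_succ, mul_comm] at hk
    obtain ⟨c, A, hAU, B, hBU, hAB, hA, hB, hsparse⟩ :=
      exists_sparse_pair (p := 2 * (6 * q) ^ k) hq U (by
        calc 3 * (q * (2 * (6 * q) ^ k)) = (6 * q) ^ (k + 1) := by ring
          _ ≤ U.card := hU) hno
    obtain ⟨W, hWA, hWc, hW⟩ := ih (by omega) A (by omega) fun u hu v hv w hw =>
      hno u (hAU hu) v (hAU hv) w (hAU hw)
    -- `W` has only `2 ^ k ≤ q / 2` vertices, each with at most `|B| / q` neighbours, so half of `B`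
    -- survives. The factor `2` in `p` pays for this.
    let N := W.biUnion fun a => B.filter (E c a)
    have hNB : N ⊆ B := Finset.biUnion_subset.2 fun a _ => Finset.filter_subset _ _
    have hN : 2 * N.card ≤ B.card := by
      have h1 : q * N.card ≤ 2 ^ k * B.card := by
        calc q * N.card ≤ q * ∑ a ∈ W, (B.filter (E c a)).card :=
              Nat.mul_le_mul_left _ Finset.card_biUnion_le
          _ = ∑ a ∈ W, q * (B.filter (E c a)).card := Finset.mul_sum _ _ _
          _ ≤ ∑ _a ∈ W, B.card := Finset.sum_le_sum fun a ha => hsparse a (hWA ha)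
          _ = 2 ^ k * B.card := by rw [Finset.sum_const, hWc, smul_eq_mul]
      have h2 : 2 ^ k * (2 * N.card) ≤ 2 ^ k * B.card := by
        calc 2 ^ k * (2 * N.card) = 2 * 2 ^ k * N.card := by ring
          _ ≤ q * N.card := Nat.mul_le_mul_right _ hk'
          _ ≤ _ := h1
      exact Nat.le_of_mul_le_mul_left h2 (by positivity)
    have hBN : B \ N ⊆ B := Finset.sdiff_subset
    obtain ⟨W', hWB, hWc', hW'⟩ := ih (by omega) (B \ N) (by
      rw [Finset.card_sdiff_of_subset hNB]; omega) fun u hu v hv w hw =>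
      hno u (hBU (hBN hu)) v (hBU (hBN hv)) w (hBU (hBN hw))
    have hd : Disjoint W W' := hAB.mono hWA (hWB.trans hBN)
    refine ⟨W ∪ W', Finset.union_subset (hWA.trans hAU) ((hWB.trans hBN).trans hBU), ?_,
      hW.union hE hW' hd c ?_⟩
    · rw [Finset.card_union_of_disjoint hd, hWc, hWc', pow_succ]
      ring
    · intro a ha b hb hab
      have hb' := Finset.mem_sdiff.1 (hWB hb)
      exact hb'.2 (Finset.mem_biUnion.2 ⟨a, ha, Finset.mem_filter.2 ⟨hb'.1, hab⟩⟩)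

end FreeSets

/-! ### Independent sets in triple systems, and embedding hedgehogs -/

section Triples

open scoped Classical

/-- Averaging: some `m`-subset of `U` contains at most the expected number of edges. -/
theorem exists_subset_card_edges_mul_choose_le {V : Type*} {k : ℕ} {H : Finset (Finset V)}
    (hH : ∀ e ∈ H, e.card = k) {m : ℕ} (U : Finset V) (hm : m ≤ U.card) :
    ∃ S ⊆ U, S.card = m ∧
      (H.filter (· ⊆ S)).card * U.card.choose k ≤ (H.filter (· ⊆ U)).card * m.choose k := by
  rcases lt_or_ge m k with hmk | hkm
  · obtain ⟨S, hS, hSm⟩ := Finset.exists_subset_card_eq hm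
    refine ⟨S, hS, hSm, ?_⟩
    rw [Finset.filter_eq_empty_iff.2]
    · simp
    · intro e he heS
      have h1 := Finset.card_le_card heS
      rw [hH e he] at h1
      omega
  induction hn : U.card generalizing U with
  | zero => exact ⟨U, subset_rfl, by omega, by rw [show m = 0 by omega]⟩
  | succ n ih =>
    rcases hm.eq_or_lt with rfl | hlt
    · exact ⟨U, subset_rfl, rfl, by rw [hn]⟩
    have hne : U.Nonempty := Finset.card_pos.1 (by omega)
    have herase : ∀ v, H.filter (· ⊆ U.erase v) = (H.filter (· ⊆ U)).filter (v ∉ ·) := by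
      intro v
      ext e
      simp only [Finset.mem_filter, Finset.subset_erase, and_assoc]
    -- Each edge survives the deletion of exactly the vertices outside it, so some single deletion
    -- does at least as well as the average.
    have hsum : ∑ v ∈ U, (H.filter (· ⊆ U.erase v)).card
        = (H.filter (· ⊆ U)).card * (n + 1 - k) := by
      have h1 : ∀ e ∈ H.filter (· ⊆ U), (U.filter (· ∉ e)).card = n + 1 - k := by
        intro e he
        rw [Finset.mem_filter] at he
        rw [Finset.filter_notMem_eq_sdiff, Finset.card_sdiff_of_subset he.2, hn, hH e he.1]
      rw [← smul_eq_mul, ← Finset.sum_const, ← Finset.sum_congr rfl h1]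
      simp only [herase, Finset.card_filter]
      exact Finset.sum_comm
    obtain ⟨v, hv, hle⟩ : ∃ v ∈ U, (H.filter (· ⊆ U.erase v)).card * (n + 1)
        ≤ (H.filter (· ⊆ U)).card * (n + 1 - k) := by
      refine Finset.exists_le_of_sum_le hne ?_
      rw [← Finset.sum_mul, hsum, Finset.sum_const, hn, smul_eq_mul, mul_comm]
    have hcard : (U.erase v).card = n := by
      rw [Finset.card_erase_of_mem hv, hn, Nat.add_sub_cancel]
    obtain ⟨S, hS, hSm, hSe⟩ := ih (U.erase v) (by omega) hcard
    refine ⟨S, hS.trans (Finset.erase_subset v U), hSm, ?_⟩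
    have hpos : 0 < n + 1 - k := by omega
    refine Nat.le_of_mul_le_mul_right ?_ hpos
    calc (H.filter (· ⊆ S)).card * (n + 1).choose k * (n + 1 - k)
        = (H.filter (· ⊆ S)).card * n.choose k * (n + 1) := by
          rw [mul_assoc, ← Nat.choose_mul_succ_eq, mul_assoc]
      _ ≤ (H.filter (· ⊆ U.erase v)).card * m.choose k * (n + 1) :=
          Nat.mul_le_mul_right _ hSe
      _ = (H.filter (· ⊆ U.erase v)).card * (n + 1) * m.choose k := by ring
      _ ≤ (H.filter (· ⊆ U)).card * (n + 1 - k) * m.choose k := Nat.mul_le_mul_right _ hle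
      _ = (H.filter (· ⊆ U)).card * m.choose k * (n + 1 - k) := by ring

/-- Deleting a vertex from every edge inside `S` leaves an independent set. -/
theorem exists_independent_subset {V : Type*} {H : Finset (Finset V)}
    (hH : ∀ e ∈ H, e.Nonempty) (S : Finset V) :
    ∃ T ⊆ S, S.card ≤ T.card + (H.filter (· ⊆ S)).card ∧ ∀ e ∈ H, ¬ e ⊆ T := by
  rcases isEmpty_or_nonempty V with hV | hV
  · refine ⟨S, subset_rfl, by omega, fun e he => ?_⟩
    obtain ⟨x, -⟩ := hH e he
    exact hV.elim x
  have hch : ∀ e : Finset V, ∃ x, e ∈ H → x ∈ e := by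
    intro e
    by_cases he : e ∈ H
    · obtain ⟨x, hx⟩ := hH e he
      exact ⟨x, fun _ => hx⟩
    · exact ⟨Classical.arbitrary V, fun h => absurd h he⟩
  choose g hg using hch
  refine ⟨S \ (H.filter (· ⊆ S)).image g, Finset.sdiff_subset, ?_, ?_⟩
  · have h1 := Finset.le_card_sdiff ((H.filter (· ⊆ S)).image g) S
    have h2 := Finset.card_image_le (s := H.filter (· ⊆ S)) (f := g)
    omega
  · intro e he hsub
    have h1 := Finset.mem_sdiff.1 (hsub (hg e he))
    exact h1.2 (Finset.mem_image_of_mem g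
      (Finset.mem_filter.2 ⟨he, hsub.trans Finset.sdiff_subset⟩))

/-- A `3`-uniform hypergraph with at most `3 T N ^ 2` edges on `N` vertices has an independent set
of order about `√(N / T)`. -/
theorem exists_independent_of_card_le {V : Type*} [Fintype V] {H : Finset (Finset V)}
    (hH : ∀ e ∈ H, e.card = 3) {T s : ℕ} (hT : 1 ≤ T)
    (hHc : H.card ≤ 3 * T * Fintype.card V ^ 2)
    (hN : 12 * T * (2 * s) ^ 2 + 2 ≤ Fintype.card V) :
    ∃ S : Finset V, s ≤ S.card ∧ ∀ e ∈ H, ¬ e ⊆ S := by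
  rcases Nat.eq_zero_or_pos s with rfl | hs
  · refine ⟨∅, by simp, fun e he hsub => ?_⟩
    have := hH e he
    rw [Finset.subset_empty.1 hsub] at this
    simp at this
  obtain ⟨n, hn⟩ : ∃ n, Fintype.card V = n + 2 := ⟨Fintype.card V - 2, by omega⟩
  rw [hn] at hHc hN
  have hN' : 12 * T * (2 * s) ^ 2 ≤ n := by omega
  have hsT : s ≤ T * s ^ 2 := by nlinarith [Nat.mul_le_mul hT (Nat.le_self_pow two_ne_zero s)]
  have hn4 : 4 * s ≤ n := by nlinarith
  -- Order `2 * s` is chosen so that at most `s` edges are expected; deleting one vertex from each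
  -- leaves `s`.
  obtain ⟨S, -, hSm, hS⟩ := exists_subset_card_edges_mul_choose_le hH (m := 2 * s)
    Finset.univ (by rw [Finset.card_univ, hn]; omega)
  obtain ⟨R, hRS, hRc, hR⟩ := exists_independent_subset
    (fun e he => Finset.card_pos.1 (by rw [hH e he]; norm_num)) (H := H) S
  refine ⟨R, ?_, hR⟩
  suffices h : (H.filter (· ⊆ S)).card ≤ s by omega
  generalize (H.filter (· ⊆ S)).card = x at hS
  have huniv : (H.filter (· ⊆ Finset.univ)).card ≤ 3 * T * (n + 2) ^ 2 :=
    (Finset.card_filter_le _ _).trans hHc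
  rw [Finset.card_univ, hn] at hS
  have h6 : 6 * (n + 2).choose 3 = (n + 2) * (n + 1) * n := by
    have := Nat.descFactorial_eq_factorial_mul_choose (n + 2) 3
    simp [Nat.descFactorial, Nat.factorial] at this
    linarith
  have h6' : 6 * (2 * s).choose 3 ≤ (2 * s) ^ 3 := by
    have := Nat.descFactorial_eq_factorial_mul_choose (2 * s) 3
    rw [show Nat.factorial 3 = 6 from rfl] at this
    rw [← this]
    exact Nat.descFactorial_le_pow _ _
  have h1 : x * ((n + 2) * (n + 1) * n) ≤ 3 * T * (n + 2) ^ 2 * (2 * s) ^ 3 := by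
    calc x * ((n + 2) * (n + 1) * n) = 6 * (x * (n + 2).choose 3) := by rw [← h6]; ring
      _ ≤ 6 * (3 * T * (n + 2) ^ 2 * (2 * s).choose 3) :=
        Nat.mul_le_mul_left _ (hS.trans (Nat.mul_le_mul_right _ huniv))
      _ = 3 * T * (n + 2) ^ 2 * (6 * (2 * s).choose 3) := by ring
      _ ≤ _ := Nat.mul_le_mul_left _ h6'
  by_contra! hx
  have h2 : 3 * T * (n + 2) ^ 2 * (2 * s) ^ 3 ≤ s * ((n + 2) * (n + 1) * n) := by
    calc 3 * T * (n + 2) ^ 2 * (2 * s) ^ 3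
        = (12 * T * (2 * s) ^ 2) * (s * (n + 2) * (n + 2)) / 2 := by
          rw [eq_comm]
          apply Nat.div_eq_of_eq_mul_left two_pos
          ring
      _ ≤ n * (s * (n + 2) * (2 * (n + 1))) / 2 := by
          apply Nat.div_le_div_right
          gcongr
          omega
      _ = s * ((n + 2) * (n + 1) * n) := by
          apply Nat.div_eq_of_eq_mul_left two_pos
          ring
  have h3 : x * ((n + 2) * (n + 1) * n) ≤ s * ((n + 2) * (n + 1) * n) := h1.trans h2
  have hpos : 0 < (n + 2) * (n + 1) * n := by
    have : 0 < n := by omega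
    positivity
  exact absurd (Nat.le_of_mul_le_mul_right h3 hpos) (not_le.2 hx)

/-- The vertices that complete the pair `u`, `v` to a triple of colour `c`. -/
noncomputable def colourLink {V : Type*} [Fintype V] (χ : Finset V → Fin 3) (c : Fin 3)
    (u v : V) : Finset V :=
  Finset.univ.filter fun w => w ≠ u ∧ w ≠ v ∧ χ {u, v, w} = c

theorem colourLink_comm {V : Type*} [Fintype V] (χ : Finset V → Fin 3) (c : Fin 3) (u v : V) :
    colourLink χ c u v = colourLink χ c v u := by
  ext w
  simp only [colourLink, Finset.mem_filter, Finset.insert_comm u v]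
  tauto

/-- The triples all of whose possible colours have a small link at some pair of the triple. -/
noncomputable def poorTriples {V : Type*} [Fintype V] (χ : Finset V → Fin 3) (T : ℕ) :
    Finset (Finset V) :=
  Finset.univ.filter fun e => e.card = 3 ∧
    ∀ c, ∃ u ∈ e, ∃ v ∈ e, u ≠ v ∧ (colourLink χ c u v).card < T

theorem mem_poorTriples {V : Type*} [Fintype V] {χ : Finset V → Fin 3} {T : ℕ} {e : Finset V} :
    e ∈ poorTriples χ T ↔ e.card = 3 ∧
      ∀ c, ∃ u ∈ e, ∃ v ∈ e, u ≠ v ∧ (colourLink χ c u v).card < T := by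
  simp only [poorTriples, Finset.mem_filter, Finset.mem_univ, true_and]

/-- Apply poverty to the triple's own colour: its third vertex lies in the small link of one of its
pairs. So colour, pair and one of fewer than `T` vertices determine it. -/
theorem card_poorTriples_le {V : Type*} [Fintype V] (χ : Finset V → Fin 3) (T : ℕ) :
    (poorTriples χ T).card ≤ 3 * T * Fintype.card V ^ 2 := by
  let f : Fin 3 × V × V → Finset (Finset V) := fun x =>
    if (colourLink χ x.1 x.2.1 x.2.2).card < T then
      (colourLink χ x.1 x.2.1 x.2.2).image fun w => {x.2.1, x.2.2, w} else ∅
  have hsub : poorTriples χ T ⊆ Finset.univ.biUnion f := by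
    intro e he
    obtain ⟨hcard, h⟩ := mem_poorTriples.1 he
    obtain ⟨u, hu, v, hv, huv, hlt⟩ := h (χ e)
    have h2 : ((e.erase u).erase v).card = 1 := by
      rw [Finset.card_erase_of_mem (Finset.mem_erase.2 ⟨huv.symm, hv⟩),
        Finset.card_erase_of_mem hu, hcard]
    obtain ⟨w, hw⟩ := Finset.card_eq_one.1 h2
    have hwm : w ∈ (e.erase u).erase v := by rw [hw]; exact Finset.mem_singleton_self w
    simp only [Finset.mem_erase] at hwm
    have he : ({u, v, w} : Finset V) = e := by
      rw [← hw, Finset.insert_erase (Finset.mem_erase.2 ⟨huv.symm, hv⟩), Finset.insert_erase hu]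
    refine Finset.mem_biUnion.2 ⟨(χ e, u, v), Finset.mem_univ _, ?_⟩
    simp only [f, if_pos hlt]
    refine Finset.mem_image.2 ⟨w, ?_, he⟩
    simp only [colourLink, Finset.mem_filter, Finset.mem_univ, true_and]
    exact ⟨hwm.2.1, hwm.1, by rw [he]⟩
  calc (poorTriples χ T).card ≤ (Finset.univ.biUnion f).card := Finset.card_le_card hsub
    _ ≤ (Finset.univ : Finset (Fin 3 × V × V)).card * T := by
      refine Finset.card_biUnion_le_card_mul _ _ _ fun x _ => ?_
      simp only [f]
      split_ifs with h
      · exact Finset.card_image_le.trans h.le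
      · simp
    _ = 3 * T * Fintype.card V ^ 2 := by
      simp only [Finset.card_univ, Fintype.card_prod, Fintype.card_fin]
      ring

/-- A set of order `t`, all of whose pairs have a link of order at least `t ^ 2` in colour `c`,
is the body of a hedgehog of colour `c`. -/
theorem exists_hedgehog_embedding {V : Type*} [Fintype V] {χ : Finset V → Fin 3} {c : Fin 3}
    {t : ℕ} {S : Finset V} (hSt : S.card = t)
    (hS : IsFree (fun u v => (colourLink χ c u v).card < t ^ 2) S) :
    ∃ f : HedgehogVertex t ↪ V, ∀ p : Set.powersetCard (Fin t) 2,
      χ (((hedgehogEdge p : Set.powersetCard (HedgehogVertex t) 3) : Finset _).map f) = c := by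
  let g : Fin t ↪ V := (S.equivFinOfCardEq hSt).symm.toEmbedding.trans (Function.Embedding.subtype _)
  have hg : ∀ i, g i ∈ S := fun i => ((S.equivFinOfCardEq hSt).symm i).2
  have hpair : ∀ p : Set.powersetCard (Fin t) 2, ∃ i j, i ≠ j ∧ (p : Finset (Fin t)) = {i, j} :=
    fun p => Finset.card_eq_two.1 p.2
  choose a b hab hp using hpair
  have hcard : Fintype.card (Set.powersetCard (Fin t) 2) = t.choose 2 := by
    rw [← Nat.card_eq_fintype_card, Set.powersetCard.card, Nat.card_fin]
  have hlarge : ∀ p, t.choose 2 ≤ (colourLink χ c (g (a p)) (g (b p)) \ S).card := by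
    intro p
    have h1 := hS _ (hg (a p)) _ (hg (b p)) (g.injective.ne (hab p))
    have h2 := Finset.le_card_sdiff S (colourLink χ c (g (a p)) (g (b p)))
    have h3 : t.choose 2 + t ≤ t ^ 2 := by
      rw [Nat.choose_two_right]
      have h4 := Nat.div_mul_le_self (t * (t - 1)) 2
      rcases t with _ | t
      · simp
      · simp only [Nat.add_sub_cancel] at h4 ⊢
        nlinarith
    omega
  -- Hall's condition is immediate: each link, even outside the body, is as large as the whole
  -- family of pairs.
  obtain ⟨k, hk, hkm⟩ := (Finset.all_card_le_biUnion_card_iff_exists_injective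
    fun p => colourLink χ c (g (a p)) (g (b p)) \ S).1 (by
      intro s
      rcases s.eq_empty_or_nonempty with rfl | ⟨p, hps⟩
      · simp
      · calc s.card ≤ t.choose 2 := hcard ▸ Finset.card_le_univ s
          _ ≤ _ := hlarge p
          _ ≤ _ := Finset.card_le_card (Finset.subset_biUnion_of_mem
              (fun p => colourLink χ c (g (a p)) (g (b p)) \ S) hps))
  refine ⟨⟨Sum.elim g k, ?_⟩, ?_⟩
  · refine g.injective.sumElim hk fun i p h => ?_
    exact (Finset.mem_sdiff.1 (hkm p)).2 (h ▸ hg i)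
  · intro p
    have h1 := (Finset.mem_filter.1 (Finset.mem_sdiff.1 (hkm p)).1).2
    refine (congrArg χ ?_).trans h1.2.2
    ext x
    simp only [hedgehogEdge, hp p, Finset.mem_map, Finset.mem_disjSum, Finset.mem_insert,
      Finset.mem_singleton, Function.Embedding.coeFn_mk]
    constructor
    · rintro ⟨y, ⟨i, hi, rfl⟩ | ⟨q, rfl, rfl⟩, rfl⟩
      · rcases hi with rfl | rfl <;> simp
      · simp
    · rintro (rfl | rfl | rfl)
      · exact ⟨Sum.inl (a p), by simp, rfl⟩
      · exact ⟨Sum.inl (b p), by simp, rfl⟩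
      · exact ⟨Sum.inr p, by simp, rfl⟩

end Triples

/-! ### Four-colourings: free-set form, bound on `F`, and the lower bound -/

section FourColourings

open scoped Classical

/-- The colours red, blue and green, indexed by `Fin 3`. -/
def nonYellow : Fin 3 → EdgeColour := ![EdgeColour.red, EdgeColour.blue, EdgeColour.green]

theorem nonYellow_injective : Function.Injective nonYellow := by
  intro i j h
  fin_cases i <;> fin_cases j <;> simp_all [nonYellow]

theorem encard_le_three_iff (C : Set EdgeColour) : C.encard ≤ 3 ↔ ∃ c, c ∉ C := by
  have hcard : ∀ a b c : EdgeColour, ({a, b, c} : Set EdgeColour).encard ≤ 3 := by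
    intro a b c
    refine (Set.encard_insert_le _ _).trans ?_
    refine (add_le_add_left (Set.encard_insert_le _ _) 1).trans ?_
    rw [Set.encard_singleton]
    norm_num
  constructor
  · intro h
    by_contra! hall
    have huniv : C = {EdgeColour.red, EdgeColour.blue, EdgeColour.green, EdgeColour.yellow} := by
      ext c
      cases c <;> simp [hall]
    rw [huniv, Set.encard_insert_of_notMem (by simp), Set.encard_insert_of_notMem (by simp),
      Set.encard_insert_of_notMem (by simp), Set.encard_singleton] at h
    norm_num at h
  · rintro ⟨c, hc⟩
    have hsub : ∀ d ∈ C, d ≠ c := fun d hd h => hc (h ▸ hd)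
    cases c
    · refine (Set.encard_le_encard fun d hd => ?_).trans
        (hcard EdgeColour.blue EdgeColour.green EdgeColour.yellow)
      have := hsub d hd
      cases d <;> simp_all
    · refine (Set.encard_le_encard fun d hd => ?_).trans
        (hcard EdgeColour.red EdgeColour.green EdgeColour.yellow)
      have := hsub d hd
      cases d <;> simp_all
    · refine (Set.encard_le_encard fun d hd => ?_).trans
        (hcard EdgeColour.red EdgeColour.blue EdgeColour.yellow)
      have := hsub d hd
      cases d <;> simp_all
    · refine (Set.encard_le_encard fun d hd => ?_).trans
        (hcard EdgeColour.red EdgeColour.blue EdgeColour.green)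
      have := hsub d hd
      cases d <;> simp_all

/-- Adjacency in colour `c`. -/
def colourAdj {n : ℕ} (χ : FourColouring n) (c : EdgeColour) (u v : Fin n) : Prop :=
  ∃ h : (⊤ : SimpleGraph (Fin n)).Adj u v, χ ⟨s(u, v), h⟩ = c

theorem colourAdj.symm {n : ℕ} {χ : FourColouring n} {c : EdgeColour} {u v : Fin n}
    (h : colourAdj χ c u v) : colourAdj χ c v u := by
  obtain ⟨h, rfl⟩ := h
  refine ⟨h.symm, ?_⟩
  congr 2
  exact Sym2.eq_swap

theorem notMem_cliqueColours_iff {n : ℕ} (χ : FourColouring n) (S : Finset (Fin n))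
    (c : EdgeColour) : c ∉ cliqueColours χ S ↔ IsFree (colourAdj χ c) S := by
  constructor
  · rintro h u hu v hv - ⟨huv, hc⟩
    refine h ⟨⟨s(u, v), huv⟩, ?_, hc⟩
    intro w hw
    rcases Sym2.mem_iff.1 hw with rfl | rfl
    · exact hu
    · exact hv
  · rintro h ⟨⟨e, he⟩, hS, hc⟩
    induction e using Sym2.ind with
    | _ u v =>
      exact h u (hS u (Sym2.mem_mk_left u v)) v (hS v (Sym2.mem_mk_right u v))
        (SimpleGraph.Adj.ne (G := ⊤) he) ⟨he, hc⟩

theorem hasRainbowTriangle_iff {n : ℕ} (χ : FourColouring n) :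
    HasRainbowTriangle χ ↔ ∃ u v w, colourAdj χ (nonYellow 0) u v ∧
      colourAdj χ (nonYellow 1) v w ∧ colourAdj χ (nonYellow 2) u w := by
  constructor
  · rintro ⟨u, v, w, huv, hvw, huw, h1, h2, h3⟩
    exact ⟨u, v, w, ⟨huv, h1⟩, ⟨hvw, h2⟩, ⟨huw, h3⟩⟩
  · rintro ⟨u, v, w, ⟨huv, h1⟩, ⟨hvw, h2⟩, ⟨huw, h3⟩⟩
    exact ⟨u, v, w, huv, hvw, huw, h1, h2, h3⟩

theorem rainbowOrClique_iff (t n : ℕ) : RainbowOrClique t n ↔ ∀ χ : FourColouring n,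
    (∃ u v w, colourAdj χ (nonYellow 0) u v ∧ colourAdj χ (nonYellow 1) v w ∧
      colourAdj χ (nonYellow 2) u w) ∨
    ∃ (c : EdgeColour) (S : Finset (Fin n)), S.card = t ∧ IsFree (colourAdj χ c) S := by
  simp only [RainbowOrClique, hasRainbowTriangle_iff, encard_le_three_iff,
    notMem_cliqueColours_iff]
  refine forall_congr' fun χ => or_congr_right ⟨?_, ?_⟩
  · rintro ⟨S, hS, c, hc⟩
    exact ⟨c, S, hS, hc⟩
  · rintro ⟨c, S, hS, hc⟩
    exact ⟨S, hS, c, hc⟩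

theorem RainbowOrClique.le {t n : ℕ} (h : RainbowOrClique t n) : t ≤ n := by
  rcases (rainbowOrClique_iff t n).1 h fun _ => EdgeColour.yellow with
    ⟨u, v, w, ⟨_, h⟩, _⟩ | ⟨c, S, hS, -⟩
  · simp [nonYellow] at h
  · rw [← hS]
    simpa using Finset.card_le_univ S

/-- The recursion with `q = 2 ^ k`; a set of order `2 ^ k ≥ t ^ 3` with a large free product has a
factor of order at least `t`. -/
theorem rainbowOrClique_of_pow_le {t k n : ℕ} (hk : 1 ≤ k) (ht : t ^ 3 ≤ 2 ^ k)
    (hn : (6 * 2 ^ k) ^ k ≤ n) : RainbowOrClique t n := by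
  rw [rainbowOrClique_iff]
  intro χ
  by_contra! hχ
  obtain ⟨hno, hS⟩ := hχ
  obtain ⟨W, -, hWc, hW⟩ := exists_hasLargeFreeProduct
    (E := fun c => colourAdj χ (nonYellow c)) (fun _ _ _ h => h.symm) k le_rfl
    (Nat.le_self_pow (by omega) 2) Finset.univ (by simpa using hn)
    (fun u _ v _ w _ h => hno v u w h.1.symm h.2.1 h.2.2)
  obtain ⟨c, S, -, hSt, hSc⟩ := hW.exists_isFree (t := t) (by omega)
  exact hS (nonYellow c) S hSt hSc

/-- Colouring a triple by one of red, blue and green that is missing in it. -/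
theorem RamseyArrows.rainbowOrClique {t n : ℕ} (h : RamseyArrows (hedgehog t) 3 n) :
    RainbowOrClique t n := by
  rw [rainbowOrClique_iff]
  intro χ
  by_contra! hχ
  obtain ⟨hno, hS⟩ := hχ
  have hmiss : ∀ e : Set.powersetCard (Fin n) 3, ∃ c : Fin 3,
      IsFree (colourAdj χ (nonYellow c)) (e : Finset (Fin n)) := by
    intro e
    by_contra! hcon
    simp only [IsFree, not_forall, not_not] at hcon
    have huniq : ∀ {c d : EdgeColour} {u v : Fin n}, colourAdj χ c u v → colourAdj χ d u v →
        c = d := by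
      rintro c d u v ⟨_, rfl⟩ ⟨_, rfl⟩
      rfl
    obtain ⟨x, y, z, hxy, hxz, hyz, he⟩ := Finset.card_eq_three.1 e.2
    have hcol : ∀ c, colourAdj χ (nonYellow c) x y ∨ colourAdj χ (nonYellow c) y z ∨
        colourAdj χ (nonYellow c) x z := by
      intro c
      obtain ⟨u, hu, v, hv, huv, hc⟩ := hcon c
      have hc' := hc.symm
      rw [he] at hu hv
      simp only [Finset.mem_insert, Finset.mem_singleton] at hu hv
      rcases hu with rfl | rfl | rfl <;> rcases hv with rfl | rfl | rfl <;>
        first | exact absurd rfl huv | tauto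
    have h01 : ∀ {u v}, colourAdj χ (nonYellow 0) u v → ¬ colourAdj χ (nonYellow 1) u v :=
      fun h h' => absurd (nonYellow_injective (huniq h h')) (by decide)
    have h02 : ∀ {u v}, colourAdj χ (nonYellow 0) u v → ¬ colourAdj χ (nonYellow 2) u v :=
      fun h h' => absurd (nonYellow_injective (huniq h h')) (by decide)
    have h12 : ∀ {u v}, colourAdj χ (nonYellow 1) u v → ¬ colourAdj χ (nonYellow 2) u v :=
      fun h h' => absurd (nonYellow_injective (huniq h h')) (by decide)
    -- Either two colours fall on the same pair, or the three colours are a permutation of the three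
    -- sides: six rainbow triangles.
    rcases hcol 0 with h0 | h0 | h0 <;> rcases hcol 1 with h1 | h1 | h1 <;>
      rcases hcol 2 with h2 | h2 | h2 <;>
      first
        | exact h01 h0 h1
        | exact h02 h0 h2
        | exact h12 h1 h2
        | exact hno x y z h0 h1 h2
        | exact hno y x z h0.symm h1 h2
        | exact hno x z y h0 h1.symm h2
        | exact hno z x y h0.symm h1 h2.symm
        | exact hno y z x h0 h1.symm h2.symm
        | exact hno z y x h0.symm h1.symm h2.symm
  choose ψ hψ using hmiss
  obtain ⟨f, c, hf⟩ := h ψ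
  refine hS (nonYellow c) (Finset.univ.image fun i : Fin t => f (Sum.inl i)) ?_ ?_
  · exact (Finset.card_image_of_injective _ (f.injective.comp Sum.inl_injective)).trans (by simp)
  · intro u hu v hv huv
    obtain ⟨i, -, rfl⟩ := Finset.mem_image.1 hu
    obtain ⟨j, -, rfl⟩ := Finset.mem_image.1 hv
    have hij : i ≠ j := fun h => huv (by rw [h])
    let p : Set.powersetCard (Fin t) 2 := ⟨{i, j}, Finset.card_pair hij⟩
    have hp := hψ (Set.powersetCard.map 3 f (hedgehogEdge p))
    rw [hf _ (Set.mem_range_self p)] at hp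
    refine hp _ ?_ _ ?_ huv <;>
      simp [hedgehogEdge, p]

end FourColourings

/-! ### From `F(t ^ 3)` to hedgehogs -/

section UpperBound

open scoped Classical

/-- If no triple of `S` has related pairs in every colour, and free subsets of `S` have order at
most `t`, then all but at most `3 * t` vertices of `S` avoid the pairs related in two colours. -/
theorem exists_subset_related_unique {V : Type*} {E : Fin 3 → V → V → Prop}
    {t : ℕ} (ht : 1 ≤ t) {S : Finset V} {M : ℕ}
    (hS : M + 3 * t ≤ S.card)
    (htri : ∀ u ∈ S, ∀ v ∈ S, ∀ w ∈ S, u ≠ v → v ≠ w → u ≠ w →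
      ¬ ∀ c, E c u v ∨ E c v w ∨ E c u w)
    (hfree : ∀ c, ∀ A ⊆ S, IsFree (E c) A → A.card ≤ t) :
    ∃ R ⊆ S, R.card = M ∧
      ∀ u ∈ R, ∀ v ∈ R, u ≠ v → ∀ c d, E c u v → E d u v → c = d := by
  -- Each `X c` is free in colour `c`: a `c`-related pair `u`, `w` in it, with the partner `v` of
  -- `u`, would see all colours. If `v = w`, any third vertex of `S` completes the triple.
  let X : Fin 3 → Finset V := fun c => S.filter fun u => ∃ v ∈ S, u ≠ v ∧ ∀ d, d ≠ c → E d u v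
  have hX : ∀ c, IsFree (E c) (X c) := by
    intro c u hu w hw huw hc
    obtain ⟨huS, v, hvS, huv, hd⟩ := Finset.mem_filter.1 hu
    have hwS := (Finset.mem_filter.1 hw).1
    by_cases hvw : v = w
    · subst hvw
      obtain ⟨x, hx, hxuv⟩ : ∃ x ∈ S, x ∉ ({u, v} : Finset V) := by
        by_contra! h
        have h1 := Finset.card_le_card (s := S) h
        have h2 := Finset.card_le_two (a := u) (b := v)
        omega
      simp only [Finset.mem_insert, Finset.mem_singleton, not_or] at hxuv
      refine htri u huS v hvS x hx huv (Ne.symm hxuv.2) (Ne.symm hxuv.1) fun d => Or.inl ?_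
      by_cases hdc : d = c
      · exact hdc ▸ hc
      · exact hd d hdc
    · refine htri u huS v hvS w hwS huv hvw huw fun d => ?_
      by_cases hdc : d = c
      · exact Or.inr (Or.inr (hdc ▸ hc))
      · exact Or.inl (hd d hdc)
  have hXc : (Finset.univ.biUnion X).card ≤ 3 * t := by
    refine (Finset.card_biUnion_le_card_mul _ _ t fun c _ =>
      hfree c _ (Finset.filter_subset _ _) (hX c)).trans ?_
    simp
  obtain ⟨R, hR, hRM⟩ := Finset.exists_subset_card_eq (s := S \ Finset.univ.biUnion X) (n := M) (by
    have := Finset.le_card_sdiff (Finset.univ.biUnion X) S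
    omega)
  refine ⟨R, hR.trans Finset.sdiff_subset, hRM, ?_⟩
  intro u hu v hv huv c d hc hd
  by_contra hcd
  obtain ⟨e, he⟩ : ∃ e : Fin 3, ∀ x, x ≠ e → x = c ∨ x = d := by
    have h3 : ∀ c d : Fin 3, c ≠ d → ∃ e : Fin 3, ∀ x, x ≠ e → x = c ∨ x = d := by decide
    exact h3 c d hcd
  have hu' := Finset.mem_sdiff.1 (hR hu)
  have hv' := Finset.mem_sdiff.1 (hR hv)
  refine hu'.2 (Finset.mem_biUnion.2 ⟨e, Finset.mem_univ e,
    Finset.mem_filter.2 ⟨hu'.1, v, hv'.1, huv, fun x hx => ?_⟩⟩)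
  rcases he x hx with rfl | rfl
  · exact hc
  · exact hd

/-- A colouring in which every pair has at most one of the colours `Fin 3`, but which has no
rainbow triangle, has a free set of order `t` on `F(t ^ 3)` vertices. -/
theorem RainbowOrClique.exists_isFree {V : Type*} {E : Fin 3 → V → V → Prop}
    (hE : ∀ c u v, E c u v → E c v u) {t M : ℕ} (ht : 1 ≤ t) (hM : RainbowOrClique (t ^ 3) M)
    {R : Finset V} (hR : R.card = M)
    (htri : ∀ u ∈ R, ∀ v ∈ R, ∀ w ∈ R, u ≠ v → v ≠ w → u ≠ w →
      ¬ ∀ c, E c u v ∨ E c v w ∨ E c u w)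
    (huniq : ∀ u ∈ R, ∀ v ∈ R, u ≠ v → ∀ c d, E c u v → E d u v → c = d) :
    ∃ c, ∃ S ⊆ R, S.card = t ∧ IsFree (E c) S := by
  have ht3 : t ≤ t ^ 3 := Nat.le_self_pow (by norm_num) t
  let g : Fin M ↪ V := (R.equivFinOfCardEq hR).symm.toEmbedding.trans
    (Function.Embedding.subtype _)
  have hg : ∀ i, g i ∈ R := fun i => ((R.equivFinOfCardEq hR).symm i).2
  have hgR : ∀ S : Finset (Fin M), S.map g ⊆ R := by
    intro S x hx
    obtain ⟨i, -, rfl⟩ := Finset.mem_map.1 hx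
    exact hg i
  have hEs : ∀ c u v, E c u v = E c v u := fun c u v => propext ⟨hE c u v, hE c v u⟩
  let f : V → V → EdgeColour := fun u v => if h : ∃ c, E c u v then nonYellow h.choose
    else EdgeColour.yellow
  have hfs : ∀ u v, f u v = f v u := by
    intro u v
    simp only [f, hEs _ u v]
  have hf : ∀ u ∈ R, ∀ v ∈ R, u ≠ v → ∀ c, f u v = nonYellow c ↔ E c u v := by
    intro u hu v hv huv c
    simp only [f]
    split_ifs with h
    · constructor
      · intro h'
        exact nonYellow_injective h' ▸ h.choose_spec
      · intro h'
        rw [huniq u hu v hv huv _ _ h.choose_spec h']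
    · constructor
      · intro h'
        fin_cases c <;> simp [nonYellow] at h'
      · exact fun h' => absurd ⟨c, h'⟩ h
  have hfy : ∀ u v, f u v ≠ EdgeColour.yellow → ∃ c, E c u v := by
    intro u v h
    by_contra h'
    exact h (dif_neg h')
  let χ : FourColouring M := fun e =>
    Sym2.lift ⟨fun i j => f (g i) (g j), fun i j => hfs _ _⟩ (e : Sym2 (Fin M))
  have hχ : ∀ c i j, colourAdj χ c i j ↔ i ≠ j ∧ f (g i) (g j) = c := by
    intro c i j
    constructor
    · rintro ⟨hij, rfl⟩
      exact ⟨hij.ne, rfl⟩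
    · rintro ⟨hij, rfl⟩
      exact ⟨hij, rfl⟩
  have hmap : ∀ c (S : Finset (Fin M)), IsFree (colourAdj χ c) S →
      ∀ u ∈ S.map g, ∀ v ∈ S.map g, u ≠ v → f u v ≠ c := by
    intro c S hS u hu v hv huv hc
    obtain ⟨i, hi, rfl⟩ := Finset.mem_map.1 hu
    obtain ⟨j, hj, rfl⟩ := Finset.mem_map.1 hv
    have hij : i ≠ j := fun h => huv (by rw [h])
    exact hS i hi j hj hij ((hχ c i j).2 ⟨hij, hc⟩)
  rcases (rainbowOrClique_iff _ _).1 hM χ with ⟨i, j, k, h0, h1, h2⟩ | ⟨c, S, hSc, hS⟩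
  · rw [hχ] at h0 h1 h2
    have hij := g.injective.ne h0.1
    have hjk := g.injective.ne h1.1
    have hik := g.injective.ne h2.1
    refine absurd ?_ (htri _ (hg i) _ (hg j) _ (hg k) hij hjk hik)
    intro c
    fin_cases c
    · exact Or.inl ((hf _ (hg i) _ (hg j) hij 0).1 h0.2)
    · exact Or.inr (Or.inl ((hf _ (hg j) _ (hg k) hjk 1).1 h1.2))
    · exact Or.inr (Or.inr ((hf _ (hg i) _ (hg k) hik 2).1 h2.2))
  -- Missing yellow means that every pair is related, so the Gallai argument applies and costs the
  -- cube. Otherwise the clique is already free.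
  by_cases hc : c = EdgeColour.yellow
  · subst hc
    have hfS := hmap _ S hS
    have hex : ∀ u ∈ S.map g, ∀ v ∈ S.map g, u ≠ v → ∃ c, E c u v :=
      fun u hu v hv huv => hfy u v (hfS u hu v hv huv)
    let φ : V → V → Fin 3 := fun u v => if h : ∃ c, E c u v then h.choose else 0
    have hφs : ∀ u v, φ u v = φ v u := by
      intro u v
      simp only [φ, hEs _ u v]
    have hφ : ∀ u ∈ S.map g, ∀ v ∈ S.map g, u ≠ v → E (φ u v) u v := by
      intro u hu v hv huv
      have h := hex u hu v hv huv
      simp only [φ, dif_pos h]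
      exact h.choose_spec
    obtain ⟨c, A, hAS, hAt, hA⟩ := (hasLargeFreeProduct_of_no_rainbow hφs (S.map g)
      (Finset.card_pos.1 (by rw [Finset.card_map]; omega)) (by
        intro u hu v hv w hw huv hvw huw
        by_contra! hne
        refine htri u (hgR S hu) v (hgR S hv) w (hgR S hw) huv hvw huw fun c => ?_
        have hcase : c = φ u v ∨ c = φ v w ∨ c = φ u w := by
          generalize φ u v = a at hne
          generalize φ v w = b at hne
          generalize φ u w = d at hne
          clear * - hne
          omega
        rcases hcase with rfl | rfl | rfl
        · exact Or.inl (hφ u hu v hv huv)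
        · exact Or.inr (Or.inl (hφ v hv w hw hvw))
        · exact Or.inr (Or.inr (hφ u hu w hw huw)))).exists_isFree (t := t) (by
          rw [Finset.card_map, hSc])
    refine ⟨c, A, hAS.trans (hgR S), hAt, fun u hu v hv huv hc => hA u hu v hv huv ?_⟩
    exact huniq u (hgR S (hAS hu)) v (hgR S (hAS hv)) huv _ _
      (hφ u (hAS hu) v (hAS hv) huv) hc
  · obtain ⟨d, rfl⟩ : ∃ d, c = nonYellow d := by
      cases c
      exacts [⟨0, rfl⟩, ⟨1, rfl⟩, ⟨2, rfl⟩, absurd rfl hc]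
    obtain ⟨A, hAS, hAt⟩ := Finset.exists_subset_card_eq (s := S.map g) (n := t) (by
      rw [Finset.card_map, hSc]; exact ht3)
    refine ⟨d, A, hAS.trans (hgR S), hAt, fun u hu v hv huv h => ?_⟩
    exact hmap _ S hS u (hAS hu) v (hAS hv) huv
      ((hf u (hgR S (hAS hu)) v (hgR S (hAS hv)) huv d).2 h)

theorem RainbowOrClique.ramseyArrows {t M N : ℕ} (ht : 1 ≤ t) (hM : RainbowOrClique (t ^ 3) M)
    (hN : 12 * t ^ 2 * (2 * (M + 3 * t)) ^ 2 + 2 ≤ N) : RamseyArrows (hedgehog t) 3 N := by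
  intro ψ
  -- The value off triples is irrelevant: links and hedgehog edges only evaluate `χ` on triples.
  let χ : Finset (Fin N) → Fin 3 := fun e => if h : e.card = 3 then ψ ⟨e, h⟩ else 0
  let E : Fin 3 → Fin N → Fin N → Prop := fun c u v => (colourLink χ c u v).card < t ^ 2
  have hE : ∀ c u v, E c u v → E c v u := fun c u v h => by
    simpa only [E, colourLink_comm χ c v u] using h
  suffices key : ∃ c, ∃ S : Finset (Fin N), S.card = t ∧ IsFree (E c) S by
    obtain ⟨c, S, hSt, hS⟩ := key
    obtain ⟨f, hf⟩ := exists_hedgehog_embedding hSt hS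
    refine ⟨f, c, ?_⟩
    rintro _ ⟨p, rfl⟩
    have hp := hf p
    simp only [χ] at hp
    rw [dif_pos (by rw [Finset.card_map]; exact (hedgehogEdge p).2)] at hp
    exact hp
  obtain ⟨S, hSc, hS⟩ := exists_independent_of_card_le (H := poorTriples χ (t ^ 2))
    (s := M + 3 * t) (fun e he => (mem_poorTriples.1 he).1) (Nat.one_le_pow _ _ ht)
    (card_poorTriples_le χ _) (by rwa [Fintype.card_fin])
  have htri : ∀ u ∈ S, ∀ v ∈ S, ∀ w ∈ S, u ≠ v → v ≠ w → u ≠ w →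
      ¬ ∀ c, E c u v ∨ E c v w ∨ E c u w := by
    intro u hu v hv w hw huv hvw huw h
    refine hS {u, v, w} (mem_poorTriples.2 ⟨
      Finset.card_eq_three.2 ⟨u, v, w, huv, huw, hvw, rfl⟩, fun c => ?_⟩) ?_
    · rcases h c with h | h | h
      · exact ⟨u, by simp, v, by simp, huv, h⟩
      · exact ⟨v, by simp, w, by simp, hvw, h⟩
      · exact ⟨u, by simp, w, by simp, huw, h⟩
    · simp [Finset.insert_subset_iff, hu, hv, hw]
  by_contra! hcon
  obtain ⟨R, hRS, hRM, huniq⟩ := exists_subset_related_unique ht hSc htri (by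
    intro c A _ hA
    by_contra! hlt
    obtain ⟨B, hBA, hBt⟩ := Finset.exists_subset_card_eq hlt.le
    exact hcon c B hBt (hA.mono hBA))
  obtain ⟨c, A, -, hAt, hA⟩ := hM.exists_isFree hE ht hRM (fun u hu v hv w hw =>
    htri u (hRS hu) v (hRS hv) w (hRS hw)) huniq
  exact hcon c A hAt hA

end UpperBound

/-! ### Finiteness and explicit constants -/

section Bounds

theorem exists_rainbowOrClique (t : ℕ) : ∃ n, RainbowOrClique t n :=
  ⟨_, rainbowOrClique_of_pow_le (k := t ^ 3 + 1) (by omega)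
    ((Nat.lt_two_pow_self (n := t ^ 3)).le.trans (Nat.pow_le_pow_right two_pos (Nat.le_succ _)))
    le_rfl⟩

theorem rainbowOrClique_rainbowF (t : ℕ) : RainbowOrClique t (rainbowF t) :=
  Nat.sInf_mem (exists_rainbowOrClique t)

theorem exists_ramseyArrows_hedgehog {t : ℕ} (ht : 1 ≤ t) :
    ∃ n, RamseyArrows (hedgehog t) 3 n :=
  ⟨_, (rainbowOrClique_rainbowF (t ^ 3)).ramseyArrows ht le_rfl⟩

/-- Since `t ≤ F`, the term `3 * t` is absorbed into `3 * F`; the constant is `12 * 8 ^ 2 + 2`. -/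
theorem ramseyNumber_hedgehog_le {t : ℕ} (ht : 1 ≤ t) :
    ramseyNumber (hedgehog t) 3 ≤ 770 * (t ^ 4 * rainbowF (t ^ 3) ^ 2) := by
  have hF := rainbowOrClique_rainbowF (t ^ 3)
  have h1 : ramseyNumber (hedgehog t) 3 ≤ 12 * t ^ 2 * (2 * (rainbowF (t ^ 3) + 3 * t)) ^ 2 + 2 :=
    Nat.sInf_le (hF.ramseyArrows ht le_rfl)
  have h2 : t ≤ rainbowF (t ^ 3) := (Nat.le_self_pow (by norm_num) t).trans hF.le
  generalize rainbowF (t ^ 3) = F at h1 h2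
  have h3 : t ^ 2 ≤ t ^ 4 := Nat.pow_le_pow_right ht (by norm_num)
  have h4 : 1 ≤ t ^ 4 * F ^ 2 := Nat.mul_pos (by positivity) (pow_pos (by omega) 2)
  calc ramseyNumber (hedgehog t) 3 ≤ 12 * t ^ 2 * (2 * (F + 3 * t)) ^ 2 + 2 := h1
    _ ≤ 12 * t ^ 4 * (2 * (F + 3 * F)) ^ 2 + 2 * (t ^ 4 * F ^ 2) := by gcongr; omega
    _ = 770 * (t ^ 4 * F ^ 2) := by ring

/-- Needed because `t ^ (c * log t)` equals `1` at `t = 1`, leaving no room for a constant. -/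
theorem ramseyArrows_hedgehog_one : RamseyArrows (hedgehog 1) 3 1 := by
  intro χ
  have hemp : IsEmpty (Set.powersetCard (Fin 1) 2) :=
    ⟨fun p => by
      have h1 : (p : Finset (Fin 1)).card = 2 := p.2
      have h2 := Finset.card_le_univ (p : Finset (Fin 1))
      simp [h1] at h2⟩
  refine ⟨⟨Sum.elim id fun p => hemp.elim p, ?_⟩, 0, ?_⟩
  · exact Function.Injective.sumElim Function.injective_id (fun p => hemp.elim p)
      fun _ p => hemp.elim p
  · rintro _ ⟨p, rfl⟩
    exact hemp.elim p

theorem rainbowF_le_exp {t : ℕ} (ht : 2 ≤ t) :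
    (rainbowF t : ℝ) ≤ Real.exp (90 * Real.log t ^ 2) := by
  have htR : (2 : ℝ) ≤ t := by exact_mod_cast ht
  have hlog2 : Real.log 2 ≤ Real.log t := Real.log_le_log two_pos htR
  have h069 := Real.log_two_gt_d9
  obtain ⟨L, hL⟩ : ∃ L, L = Nat.clog 2 t := ⟨_, rfl⟩
  have hL1 : 1 ≤ L := hL ▸ Nat.clog_pos one_lt_two ht
  have hLt : t ≤ 2 ^ L := hL ▸ Nat.le_pow_clog one_lt_two t
  have hLt' : 2 ^ (L - 1) < t := by
    rw [hL]
    exact Nat.pow_pred_clog_lt_self one_lt_two (by omega)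
  have hLlog : L * Real.log 2 ≤ 2 * Real.log t := by
    have h1 : ((2 : ℝ) ^ L) ≤ (t : ℝ) * 2 := by
      have h2 : 2 ^ L = 2 ^ (L - 1) * 2 := by rw [← pow_succ, Nat.sub_add_cancel hL1]
      have h3 : 2 ^ L ≤ t * 2 := by omega
      exact_mod_cast h3
    have h4 := Real.log_le_log (by positivity) h1
    rw [Real.log_pow, Real.log_mul (by positivity) (by norm_num)] at h4
    linarith
  have hL3 : (L : ℝ) ≤ 3 * Real.log t := by nlinarith
  have h6 : Real.log 6 ≤ 4 * Real.log t := by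
    have h1 : Real.log 6 ≤ Real.log ((2 : ℝ) ^ 4) := Real.log_le_log (by norm_num) (by norm_num)
    rw [Real.log_pow] at h1
    push_cast at h1
    linarith
  -- With `k = 3 * L`, the logarithm is at most `9 * log t * (4 + 6) * log t`, whence the `90`.
  have hF : rainbowF t ≤ (6 * 2 ^ (3 * L)) ^ (3 * L) := by
    refine Nat.sInf_le (rainbowOrClique_of_pow_le (by omega) ?_ le_rfl)
    calc t ^ 3 ≤ (2 ^ L) ^ 3 := Nat.pow_le_pow_left hLt 3
      _ = 2 ^ (3 * L) := by rw [← pow_mul, mul_comm]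
  have hpos : (0 : ℝ) < (6 * 2 ^ (3 * L)) ^ (3 * L) := by positivity
  calc (rainbowF t : ℝ) ≤ (6 * 2 ^ (3 * L)) ^ (3 * L) := by exact_mod_cast hF
    _ = Real.exp (Real.log ((6 * 2 ^ (3 * L)) ^ (3 * L))) := (Real.exp_log hpos).symm
    _ ≤ Real.exp (90 * Real.log t ^ 2) := by
      rw [Real.exp_le_exp, Real.log_pow, Real.log_mul (by norm_num) (by positivity),
        Real.log_pow]
      push_cast
      have hlog : 0 ≤ Real.log t := by linarith
      have hsum : Real.log 6 + 3 * L * Real.log 2 ≤ 10 * Real.log t := by linarith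
      calc 3 * (L : ℝ) * (Real.log 6 + 3 * L * Real.log 2)
          ≤ 3 * (3 * Real.log t) * (10 * Real.log t) := by
            have : 0 ≤ Real.log 6 + 3 * L * Real.log 2 := by positivity
            gcongr
        _ = 90 * Real.log t ^ 2 := by ring

theorem ramseyNumber_hedgehog_le_rpow {t : ℕ} (ht : 1 ≤ t) :
    (ramseyNumber (hedgehog t) 3 : ℝ) ≤ (t : ℝ) ^ (2000 * Real.log (t : ℝ)) := by
  rcases ht.eq_or_lt with rfl | ht2
  · have h1 : ramseyNumber (hedgehog 1) 3 ≤ 1 := Nat.sInf_le ramseyArrows_hedgehog_one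
    simpa using h1
  have htR : (2 : ℝ) ≤ t := by exact_mod_cast ht2
  have htpos : (0 : ℝ) < t := by linarith
  have hlog2 : Real.log 2 ≤ Real.log t := Real.log_le_log two_pos htR
  have h069 := Real.log_two_gt_d9
  have hF := rainbowF_le_exp (t := t ^ 3) (ht2.trans_le (Nat.le_self_pow (by norm_num) t))
  rw [Nat.cast_pow, Real.log_pow] at hF
  have h1 : (ramseyNumber (hedgehog t) 3 : ℝ) ≤ 770 * ((t : ℝ) ^ 4 * (rainbowF (t ^ 3) : ℝ) ^ 2) := by
    exact_mod_cast ramseyNumber_hedgehog_le ht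
  have h770 : (770 : ℝ) ≤ (t : ℝ) ^ 10 := by
    calc (770 : ℝ) ≤ 2 ^ 10 := by norm_num
      _ ≤ (t : ℝ) ^ 10 := by gcongr
  calc (ramseyNumber (hedgehog t) 3 : ℝ)
      ≤ 770 * ((t : ℝ) ^ 4 * (rainbowF (t ^ 3) : ℝ) ^ 2) := h1
    _ ≤ (t : ℝ) ^ 10 * ((t : ℝ) ^ 4
        * Real.exp (90 * (((3 : ℕ) : ℝ) * Real.log t) ^ 2) ^ 2) := by gcongr
    _ = (t : ℝ) ^ 14 * Real.exp (1620 * Real.log t ^ 2) := by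
      rw [← Real.exp_nat_mul, ← mul_assoc, ← pow_add]
      congr 2
      push_cast
      ring
    _ = Real.exp (14 * Real.log t + 1620 * Real.log t ^ 2) := by
      rw [Real.exp_add, show (14 : ℝ) = ((14 : ℕ) : ℝ) by norm_num, Real.exp_nat_mul,
        Real.exp_log htpos]
    -- The linear term is absorbed because `log t ≥ log 2`; `1620` is `2 * 90 * 3 ^ 2`.
    _ ≤ Real.exp (Real.log t * (2000 * Real.log t)) := by
      rw [Real.exp_le_exp]
      nlinarith
    _ = (t : ℝ) ^ (2000 * Real.log (t : ℝ)) := (Real.rpow_def_of_pos htpos _).symm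

end Bounds

theorem theorem2 :
    -- the two minima that define the Ramsey number and `F` exist
    (∀ t : ℕ, 1 ≤ t →
      IsLeast {n : ℕ | RamseyArrows (hedgehog t) 3 n} (ramseyNumber (hedgehog t) 3) ∧
      IsLeast {n : ℕ | RainbowOrClique t n} (rainbowF t)) ∧
    (∃ C : ℝ, 0 < C ∧ ∀ t : ℕ, 1 ≤ t →
      (ramseyNumber (hedgehog t) 3 : ℝ) ≤ C * ((t : ℝ) ^ 4 * (rainbowF (t ^ 3) : ℝ) ^ 2)) ∧
    (∀ t : ℕ, 1 ≤ t → rainbowF t ≤ ramseyNumber (hedgehog t) 3) ∧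
    (∃ c : ℝ, 0 < c ∧ ∀ t : ℕ, 1 ≤ t →
      (ramseyNumber (hedgehog t) 3 : ℝ) ≤ (t : ℝ) ^ (c * Real.log (t : ℝ))) := by
  have hr : ∀ t : ℕ, 1 ≤ t → RamseyArrows (hedgehog t) 3 (ramseyNumber (hedgehog t) 3) :=
    fun t ht => Nat.sInf_mem (exists_ramseyArrows_hedgehog ht)
  refine ⟨fun t ht => ⟨⟨hr t ht, fun n hn => Nat.sInf_le hn⟩,
    ⟨rainbowOrClique_rainbowF t, fun n hn => Nat.sInf_le hn⟩⟩, ⟨770, by norm_num, ?_⟩, ?_,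
    ⟨2000, by norm_num, fun t ht => ramseyNumber_hedgehog_le_rpow ht⟩⟩
  · intro t ht
    exact_mod_cast ramseyNumber_hedgehog_le ht
  · intro t ht
    exact Nat.sInf_le (hr t ht).rainbowOrClique
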